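/- Let $\alpha_1,\alpha_2,\lambda_1,\lambda_2>0$, and let $X\sim\mathrm{Gamma}(\alpha_1,\lambda_1)$ and $Y\sim\mathrm{Gamma}(\alpha_2,\lambda_2)$ be random variables (shape–rate parametrization: $\mathrm{Gamma}(\alpha,\lambda)$ has density $\frac{\lambda^{\alpha}}{\Gamma(\alpha)}t^{\alpha-1}e^{-\lambda t}$, $t>0$), with distribution functions $F_X$ and $F_Y$. (Only the marginal laws matter; in particular $X$ and $Y$ may be independent.) Let $x$ be a real number with $x>-\lambda_1$ and $x>-\lambda_2$; in particular any $x\ge 0$ is allowed. Then $\left|\frac{x+\lambda_2}{2x+\lambda_1+\lambda_2}\right|<1$, all the integrals below converge absolutely, and $$\int_0^\infty\left[\int_0^u e^{-vx}\,dF_Y(v)\right]u\,e^{-ux}\,dF_X(u)=\frac{\lambda_1^{\alpha_1}\lambda_2^{\alpha_2}}{\mathrm{B}(\alpha_1,\alpha_2+1)}\;\frac{{}_2F_1\!\left(\alpha_1+\alpha_2+1,1;\alpha_2+1;\frac{x+\lambda_2}{2x+\lambda_1+\lambda_2}\right)}{(2x+\lambda_1+\lambda_2)^{\alpha_1+\alpha_2+1}}$$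 and $$\int_0^\infty\left[\int_0^u v\,e^{-vx}\,dF_Y(v)\right]e^{-ux}\,dF_X(u)=\frac{\lambda_1^{\alpha_1}\lambda_2^{\alpha_2}}{\mathrm{B}(\alpha_1,\alpha_2)}\;\frac{{}_2F_1\!\left(\alpha_1+\alpha_2,1;\alpha_2+1;\frac{x+\lambda_2}{2x+\lambda_1+\lambda_2}\right)}{(x+\lambda_2)(2x+\lambda_1+\lambda_2)^{\alpha_1+\alpha_2}}-\frac{\lambda_1^{\alpha_1}\lambda_2^{\alpha_2}}{\mathrm{B}(\alpha_1,\alpha_2)}\;\frac{1}{(x+\lambda_2)(2x+\lambda_1+\lambda_2)^{\alpha_1+\alpha_2}}.$$ Here $\mathrm{B}(a,b)=\int_0^1t^{a-1}(1-t)^{b-1}\,dt$ is the beta function, and ${}_2F_1(a,b;c;z)=\sum_{n=0}^\infty\frac{(a)_n(b)_n}{(c)_n}\frac{z^n}{n!}$ for $|z|<1$ is the hypergeometric function, where $(q)_0=1$ and $(q)_n=q(q+1)\cdots(q+n-1)$ for $n>0$. -/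

import Mathlib

open MeasureTheory ProbabilityTheory

/-- The complete beta function `B(a, b) = ∫₀¹ t^(a-1) (1-t)^(b-1) dt` for real `a, b > 0`. -/
noncomputable def betaFn (a b : ℝ) : ℝ :=
  ∫ t in (0 : ℝ)..1, t ^ (a - 1) * (1 - t) ^ (b - 1)

/-- The Lebesgue–Stieltjes measure `dF_X` of the distribution function
`F_X(t) = P(X ≤ t)` of a real random variable `X`. -/
noncomputable def dF {Ω : Type*} [MeasurableSpace Ω] (P : Measure Ω) (X : Ω → ℝ) : Measure ℝ :=
  (cdf (P.map X)).measure

/-!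
Put `p = x + lam₁` and `q = x + lam₂`; both are positive. The measures `dF P X` and `dF P Y` are the
gamma measures themselves, so both double integrals are, up to the normalizing constants of the
densities, of the form
`J(a, b) = ∫₀^∞ (∫₀^u v^(b-1) e^(-qv) dv) u^(a-1) e^(-pu) du`,
with `(a, b) = (α₁ + 1, α₂)` in the first case and `(a, b) = (α₁, α₂ + 1)` in the second.

Writing `e^(-qv) = e^(-qu) e^(q(u-v))` and expanding the second factor turns the inner integral into
beta integrals with positive coefficients (`hasSum_integral_rpow_mul_exp_neg_Ioc`):
`∫₀^u v^(b-1) e^(-qv) dv = e^(-qu) ∑ₙ qⁿ u^(b+n) Γ(b) / Γ(b+n+1)`.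
Integrating this over `u`, again term by term (`hasSum_integral_lowerGamma`), gives
`J(a, b) = ∑ₙ qⁿ Γ(b) Γ(a+b+n) / (Γ(b+n+1) (p+q)^(a+b+n))`, which is
`Γ(a+b) / (b (p+q)^(a+b)) · ₂F₁(a+b, 1; b+1; q/(p+q))` (`integral_lowerGamma_mul_rpow_mul_exp`).
The ratio test justifies both interchanges: consecutive terms have ratios tending to `0` in the
series for the inner integral and to `q/(p+q) < 1` in the series for `J`.

The first closed form is this formula. The second is obtained from it by the identity
`₂F₁(a, 1; c; z) = 1 + (a/c) z ₂F₁(a+1, 1; c+1; z)` (`ordinaryHypergeometric_one_eq_one_add`), whose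
constant term accounts for the subtracted summand.
-/

/-! ### Ratios of Gamma values and the series `₂F₁ a 1 c` -/

open Filter Topology in
/-- Ratio test for positive terms, with the ratio given explicitly. -/
theorem summable_of_tendsto_ratio {f : ℕ → ℝ} {r : ℕ → ℝ} {l : ℝ} (hl : |l| < 1)
    (hf : ∀ n, 0 < f n) (hr : ∀ n, f (n + 1) = r n * f n) (h : Tendsto r atTop (𝓝 l)) :
    Summable f := by
  refine summable_of_ratio_test_tendsto_lt_one hl (.of_forall fun n => (hf n).ne') ?_
  refine h.abs.congr fun n => ?_
  rw [hr, norm_mul, mul_div_assoc, div_self (norm_pos_iff.2 (hf n).ne').ne', mul_one,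
    Real.norm_eq_abs]

theorem Gamma_add_nat_succ {a : ℝ} (ha : 0 < a) (n : ℕ) :
    Real.Gamma (a + (n + 1 : ℕ)) = (a + n) * Real.Gamma (a + n) := by
  have h : a + (n : ℝ) ≠ 0 := by positivity
  rw [← Real.Gamma_add_one h]
  push_cast
  ring_nf

theorem Gamma_add_nat_eq_ascPochhammer {a : ℝ} (ha : 0 < a) (n : ℕ) :
    Real.Gamma (a + n) = (ascPochhammer ℝ n).eval a * Real.Gamma a := by
  induction n with
  | zero => simp
  | succ n ih => rw [Gamma_add_nat_succ ha, ih, ascPochhammer_succ_eval]; ring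

open Filter Topology in
/-- The series `∑ yⁿ / (c)ₙ`, up to the factor `Γ(c)`, converges for every `y`. -/
theorem summable_pow_div_Gamma {c y : ℝ} (hc : 0 < c) (hy : 0 < y) :
    Summable fun n : ℕ => y ^ n / Real.Gamma (c + n) := by
  have hpos (n : ℕ) : 0 < Real.Gamma (c + n) := Real.Gamma_pos_of_pos (by positivity)
  refine summable_of_tendsto_ratio (r := fun n : ℕ => y / (c + n)) (l := 0) (by simp)
    (fun n => div_pos (by positivity) (hpos n)) (fun n => ?_) ?_
  · have := hpos n
    rw [Gamma_add_nat_succ hc, pow_succ']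
    field_simp
  · exact tendsto_const_nhds.div_atTop
      (tendsto_atTop_add_const_left _ _ tendsto_natCast_atTop_atTop)

open Filter Topology in
theorem summable_Gamma_div_Gamma_mul_pow {a c z : ℝ} (ha : 0 < a) (hc : 0 < c) (hz : 0 < z)
    (hz1 : z < 1) :
    Summable fun n : ℕ => Real.Gamma (a + n) / Real.Gamma (c + n) * z ^ n := by
  have hposa (n : ℕ) : 0 < Real.Gamma (a + n) := Real.Gamma_pos_of_pos (by positivity)
  have hpos (n : ℕ) : 0 < Real.Gamma (c + n) := Real.Gamma_pos_of_pos (by positivity)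
  refine summable_of_tendsto_ratio (r := fun n : ℕ => (a + n) / (c + n) * z) (l := z)
    (by rwa [abs_of_pos hz])
    (fun n => mul_pos (div_pos (hposa n) (hpos n)) (by positivity)) (fun n => ?_) ?_
  · have := hpos n
    have h2 := hposa n
    rw [Gamma_add_nat_succ hc, Gamma_add_nat_succ ha, pow_succ']
    field_simp
  · have h := tendsto_add_mul_div_add_mul_atTop_nhds a c 1 (d := (1 : ℝ)) one_ne_zero
    simpa using h.mul_const z

/-- When the second parameter is `1`, its Pochhammer symbol cancels the `n!` of the hypergeometric
series, and the two remaining symbols are quotients of Gamma values. -/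
theorem hasSum_ordinaryHypergeometric_one {a c z : ℝ} (ha : 0 < a) (hc : 0 < c) (hz : 0 < z)
    (hz1 : z < 1) :
    HasSum (fun n : ℕ => Real.Gamma (a + n) / Real.Gamma (c + n) * z ^ n)
      (Real.Gamma a / Real.Gamma c * ₂F₁ a 1 c z) := by
  have hΓa := Real.Gamma_pos_of_pos ha
  have hΓc := Real.Gamma_pos_of_pos hc
  convert (summable_Gamma_div_Gamma_mul_pow ha hc hz hz1).hasSum using 1
  rw [ordinaryHypergeometric_eq_tsum, ← tsum_mul_left]
  refine tsum_congr fun n => ?_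
  have := ascPochhammer_pos n c hc
  rw [Gamma_add_nat_eq_ascPochhammer ha, Gamma_add_nat_eq_ascPochhammer hc,
    ascPochhammer_eval_one, smul_eq_mul]
  field_simp

/-- Splitting off the constant term of `₂F₁ a 1 c` and shifting the index. -/
theorem ordinaryHypergeometric_one_eq_one_add {a c z : ℝ} (ha : 0 < a) (hc : 0 < c) (hz : 0 < z)
    (hz1 : z < 1) :
    ₂F₁ a 1 c z = 1 + a / c * z * ₂F₁ (a + 1) 1 (c + 1) z := by
  have hΓa := Real.Gamma_pos_of_pos ha
  have hΓc := Real.Gamma_pos_of_pos hc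
  have h0 := (hasSum_nat_add_iff' 1).2 (hasSum_ordinaryHypergeometric_one ha hc hz hz1)
  have h1 := (hasSum_ordinaryHypergeometric_one (a := a + 1) (c := c + 1)
    (by positivity) (by positivity) hz hz1).mul_right z
  have h := h0.unique (h1.congr_fun fun n => by
    push_cast; rw [pow_succ, add_right_comm a, add_right_comm c, add_assoc a, add_assoc c]; ring)
  simp only [Finset.range_one, Finset.sum_singleton, Nat.cast_zero, add_zero, pow_zero,
    mul_one] at h
  rw [Real.Gamma_add_one ha.ne', Real.Gamma_add_one hc.ne'] at h
  field_simp at h ⊢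
  linarith

/-! ### The beta integral and the lower incomplete gamma integral -/

/-- The beta integral scaled to `[0, u]`; here `beta b c` is `Γ(b) Γ(c) / Γ(b + c)`. -/
theorem integral_rpow_mul_sub_rpow {b c u : ℝ} (hb : 0 < b) (hc : 0 < c) (hu : 0 < u) :
    ∫ v in (0 : ℝ)..u, v ^ (b - 1) * (u - v) ^ (c - 1) = u ^ (b + c - 1) * beta b c := by
  have h := Complex.betaIntegral_scaled b c hu
  rw [Complex.betaIntegral_eq_Gamma_mul_div _ _ (by simpa) (by simpa)] at h
  rw [beta, ← Complex.ofReal_inj, ← intervalIntegral.integral_ofReal]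
  push_cast [Complex.ofReal_cpow hu.le, ← Complex.Gamma_ofReal]
  rw [← h]
  simp_rw [intervalIntegral.integral_of_le hu.le]
  refine setIntegral_congr_fun measurableSet_Ioc fun v hv => ?_
  rw [Complex.ofReal_cpow hv.1.le, Complex.ofReal_cpow (sub_nonneg.2 hv.2)]
  push_cast
  rfl

theorem betaFn_eq_beta {a b : ℝ} (ha : 0 < a) (hb : 0 < b) : betaFn a b = beta a b := by
  simpa [betaFn] using integral_rpow_mul_sub_rpow ha hb one_pos

/-- Power series of the lower incomplete gamma integral. Its terms are positive because the series
comes from expanding `exp (q (u - v))` in `exp (-q v) = exp (-q u) * exp (q (u - v))`; expanding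
`exp (-q v)` itself would give an alternating series. -/
theorem hasSum_integral_rpow_mul_exp_neg_Ioc {b q u : ℝ} (hb : 0 < b) (hq : 0 < q)
    (hu : 0 < u) :
    HasSum (fun n : ℕ => Real.exp (-(q * u)) * q ^ n *
        (Real.Gamma b / Real.Gamma (b + 1 + n)) * u ^ (b + n))
      (∫ v in Set.Ioc 0 u, v ^ (b - 1) * Real.exp (-(q * v))) := by
  set F : ℕ → ℝ → ℝ := fun n v =>
    Real.exp (-(q * u)) * q ^ n / n.factorial * (v ^ (b - 1) * (u - v) ^ n) with hF
  have hval (n : ℕ) : ∫ v in Set.Ioc 0 u, F n v = Real.exp (-(q * u)) * q ^ n *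
        (Real.Gamma b / Real.Gamma (b + 1 + n)) * u ^ (b + n) := by
    have h := integral_rpow_mul_sub_rpow hb (c := n + 1) (by positivity) hu
    simp only [add_sub_cancel_right, Real.rpow_natCast] at h
    rw [← intervalIntegral.integral_of_le hu.le, hF, intervalIntegral.integral_const_mul, h,
      beta, Real.Gamma_nat_eq_factorial, show b + ((n : ℝ) + 1) - 1 = b + n by ring,
      show b + ((n : ℝ) + 1) = b + 1 + n by ring]
    have := Real.Gamma_pos_of_pos (show 0 < b + 1 + n by positivity)
    field_simp
  have hpos (n : ℕ) : 0 < Real.exp (-(q * u)) * q ^ n *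
        (Real.Gamma b / Real.Gamma (b + 1 + n)) * u ^ (b + n) := by
    have := Real.Gamma_pos_of_pos (show 0 < b + 1 + n by positivity)
    have := Real.Gamma_pos_of_pos hb
    positivity
  -- A function with nonzero integral is integrable: the integral defaults to `0` otherwise.
  have hint (n : ℕ) : IntegrableOn (F n) (Set.Ioc 0 u) :=
    .of_integral_ne_zero (by rw [hval]; exact (hpos n).ne')
  have hnorm (n : ℕ) : ∫ v in Set.Ioc 0 u, ‖F n v‖ = ∫ v in Set.Ioc 0 u, F n v := by
    refine setIntegral_congr_fun measurableSet_Ioc fun v hv => Real.norm_of_nonneg ?_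
    have h1 := hv.1.le
    have h2 := sub_nonneg.2 hv.2
    positivity
  have key := hasSum_integral_of_summable_integral_norm hint (by
    simp_rw [hnorm, hval]
    refine ((summable_pow_div_Gamma (c := b + 1) (by positivity) (mul_pos hq hu)).mul_left
      (Real.exp (-(q * u)) * Real.Gamma b * u ^ b)).congr fun n => ?_
    rw [Real.rpow_add hu, Real.rpow_natCast]
    ring)
  simp_rw [hval] at key
  have hsum : ∫ v in Set.Ioc 0 u, v ^ (b - 1) * Real.exp (-(q * v)) =
      ∫ v in Set.Ioc 0 u, ∑' n, F n v := by
    refine setIntegral_congr_fun measurableSet_Ioc fun v hv => ?_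
    have hexp := (NormedSpace.expSeries_div_hasSum_exp (𝔸 := ℝ) (q * (u - v)))
    rw [← Real.exp_eq_exp_ℝ] at hexp
    have h : HasSum (fun n => F n v)
        (Real.exp (-(q * u)) * v ^ (b - 1) * Real.exp (q * (u - v))) :=
      (hexp.mul_left _).congr_fun fun n => by simp only [hF, mul_pow]; ring
    rw [h.tsum_eq, show -(q * v) = -(q * u) + q * (u - v) by ring, Real.exp_add]
    ring
  rw [hsum]
  exact key

/-- Integrating the series of `hasSum_integral_rpow_mul_exp_neg_Ioc` term by term against a gamma
weight; each term is a complete gamma integral with rate `p + q`. -/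
theorem hasSum_integral_lowerGamma {a b p q : ℝ} (ha : 0 < a) (hb : 0 < b) (hp : 0 < p)
    (hq : 0 < q) :
    HasSum (fun n : ℕ => q ^ n * (Real.Gamma b / Real.Gamma (b + 1 + n)) *
        (Real.Gamma (a + b + n) / (p + q) ^ (a + b + n)))
      (∫ u in Set.Ioi 0, (∫ v in Set.Ioc 0 u, v ^ (b - 1) * Real.exp (-(q * v))) *
        (u ^ (a - 1) * Real.exp (-(p * u)))) := by
  set F : ℕ → ℝ → ℝ := fun n u => q ^ n * (Real.Gamma b / Real.Gamma (b + 1 + n)) *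
    (u ^ (a + b + n - 1) * Real.exp (-((p + q) * u))) with hF
  have hval (n : ℕ) : ∫ u in Set.Ioi 0, F n u =
      q ^ n * (Real.Gamma b / Real.Gamma (b + 1 + n)) *
        (Real.Gamma (a + b + n) / (p + q) ^ (a + b + n)) := by
    rw [hF, integral_const_mul, Real.integral_rpow_mul_exp_neg_mul_Ioi (by positivity)
      (by positivity), Real.div_rpow zero_le_one (by positivity), Real.one_rpow]
    ring
  have hΓb := Real.Gamma_pos_of_pos hb
  have hΓ (n : ℕ) := Real.Gamma_pos_of_pos (show 0 < b + 1 + n by positivity)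
  have hint (n : ℕ) : IntegrableOn (F n) (Set.Ioi 0) := by
    refine .of_integral_ne_zero ?_
    have := hΓ n
    have := Real.Gamma_pos_of_pos (show 0 < a + b + n by positivity)
    rw [hval]
    positivity
  have hnorm (n : ℕ) : ∫ u in Set.Ioi 0, ‖F n u‖ = ∫ u in Set.Ioi 0, F n u := by
    refine setIntegral_congr_fun measurableSet_Ioi fun u (hu : 0 < u) => Real.norm_of_nonneg ?_
    have := hΓ n
    positivity
  have key := hasSum_integral_of_summable_integral_norm hint (by
    simp_rw [hnorm, hval]
    refine ((summable_Gamma_div_Gamma_mul_pow (a := a + b) (c := b + 1) (z := q / (p + q))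
      (by positivity) (by positivity) (by positivity)
      ((div_lt_one (by positivity)).2 (by linarith))).mul_left
      (Real.Gamma b / (p + q) ^ (a + b))).congr fun n => ?_
    rw [Real.rpow_add (by positivity) (a + b), Real.rpow_natCast, div_pow]
    have := hΓ n
    field_simp)
  simp_rw [hval] at key
  have hsum : ∫ u in Set.Ioi 0, (∫ v in Set.Ioc 0 u, v ^ (b - 1) * Real.exp (-(q * v))) *
      (u ^ (a - 1) * Real.exp (-(p * u))) = ∫ u in Set.Ioi 0, ∑' n, F n u := by
    refine setIntegral_congr_fun measurableSet_Ioi fun u (hu : 0 < u) => ?_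
    rw [← ((hasSum_integral_rpow_mul_exp_neg_Ioc hb hq hu).mul_right
      (u ^ (a - 1) * Real.exp (-(p * u)))).tsum_eq]
    refine tsum_congr fun n => ?_
    simp only [hF]
    rw [show a + b + n - 1 = (b + n) + (a - 1) by ring, Real.rpow_add hu (b + n),
      show -((p + q) * u) = -(p * u) + -(q * u) by ring, Real.exp_add]
    ring
  rw [hsum]
  exact key

theorem integral_lowerGamma_mul_rpow_mul_exp {a b p q : ℝ} (ha : 0 < a) (hb : 0 < b)
    (hp : 0 < p) (hq : 0 < q) :
    ∫ u in Set.Ioi 0, (∫ v in Set.Ioc 0 u, v ^ (b - 1) * Real.exp (-(q * v))) *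
        (u ^ (a - 1) * Real.exp (-(p * u))) =
      Real.Gamma (a + b) / (b * (p + q) ^ (a + b)) * ₂F₁ (a + b) 1 (b + 1) (q / (p + q)) := by
  have hΓb := Real.Gamma_pos_of_pos hb
  have h := (hasSum_ordinaryHypergeometric_one (a := a + b) (c := b + 1) (z := q / (p + q))
    (by positivity) (by positivity) (by positivity)
    ((div_lt_one (by positivity)).2 (by linarith))).mul_left
    (Real.Gamma b / (p + q) ^ (a + b))
  rw [(hasSum_integral_lowerGamma ha hb hp hq).unique (h.congr_fun fun n => ?_),
    Real.Gamma_add_one hb.ne']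
  · field_simp
  · rw [Real.rpow_add (by positivity) (a + b), Real.rpow_natCast, div_pow]
    have := Real.Gamma_pos_of_pos (show 0 < b + 1 + n by positivity)
    field_simp

theorem integrableOn_rpow_mul_exp_neg_Ioi {b q : ℝ} (hb : 0 < b) (hq : 0 < q) :
    IntegrableOn (fun v : ℝ => v ^ (b - 1) * Real.exp (-(q * v))) (Set.Ioi 0) := by
  refine .of_integral_ne_zero ?_
  rw [Real.integral_rpow_mul_exp_neg_mul_Ioi hb hq]
  have := Real.Gamma_pos_of_pos hb
  positivity

/-- Integrability follows from the value of the integral: it is a sum of positive terms, hence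
nonzero, whereas the integral of a non-integrable function is `0` by convention. -/
theorem integrableOn_lowerGamma_mul_rpow_mul_exp {a b p q : ℝ} (ha : 0 < a) (hb : 0 < b)
    (hp : 0 < p) (hq : 0 < q) :
    IntegrableOn (fun u => (∫ v in Set.Ioc 0 u, v ^ (b - 1) * Real.exp (-(q * v))) *
        (u ^ (a - 1) * Real.exp (-(p * u)))) (Set.Ioi 0) := by
  refine .of_integral_ne_zero ?_
  have h := hasSum_integral_lowerGamma ha hb hp hq
  have hpos (n : ℕ) : 0 < q ^ n * (Real.Gamma b / Real.Gamma (b + 1 + n)) *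
        (Real.Gamma (a + b + n) / (p + q) ^ (a + b + n)) := by
    have := Real.Gamma_pos_of_pos hb
    have := Real.Gamma_pos_of_pos (show 0 < b + 1 + n by positivity)
    have := Real.Gamma_pos_of_pos (show 0 < a + b + n by positivity)
    positivity
  rw [← h.tsum_eq]
  exact (h.summable.tsum_pos (fun n => (hpos n).le) 0 (hpos 0)).ne'

/-! ### Integration against the gamma distribution -/

theorem measurable_gammaPDF (a r : ℝ) : Measurable (gammaPDF a r) :=
  (measurable_gammaPDFReal a r).ennreal_ofReal

theorem gammaPDF_toReal_smul {a r t : ℝ} (ha : 0 < a) (hr : 0 < r) (ht : 0 < t) (y : ℝ) :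
    (gammaPDF a r t).toReal • y =
      r ^ a / Real.Gamma a * (t ^ (a - 1) * Real.exp (-(r * t)) * y) := by
  rw [gammaPDF, ENNReal.toReal_ofReal (gammaPDFReal_nonneg ha hr t), gammaPDFReal, if_pos ht.le,
    smul_eq_mul]
  ring

theorem setIntegral_gammaMeasure {a r : ℝ} (ha : 0 < a) (hr : 0 < r) {s : Set ℝ}
    (hs : MeasurableSet s) (hs0 : s ⊆ Set.Ioi 0) (f : ℝ → ℝ) :
    ∫ t in s, f t ∂(gammaMeasure a r) =
      r ^ a / Real.Gamma a * ∫ t in s, t ^ (a - 1) * Real.exp (-(r * t)) * f t := by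
  rw [gammaMeasure, restrict_withDensity hs, integral_withDensity_eq_integral_toReal_smul
    (measurable_gammaPDF a r) (.of_forall fun _ => ENNReal.ofReal_lt_top),
    ← integral_const_mul]
  exact setIntegral_congr_fun hs fun t ht => gammaPDF_toReal_smul ha hr (hs0 ht) _

theorem integrableOn_gammaMeasure {a r : ℝ} (ha : 0 < a) (hr : 0 < r) {s : Set ℝ}
    (hs : MeasurableSet s) (hs0 : s ⊆ Set.Ioi 0) {f : ℝ → ℝ}
    (hf : IntegrableOn (fun t => t ^ (a - 1) * Real.exp (-(r * t)) * f t) s) :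
    IntegrableOn f s (gammaMeasure a r) := by
  rw [IntegrableOn, gammaMeasure, restrict_withDensity hs,
    integrable_withDensity_iff_integrable_smul'
    (measurable_gammaPDF a r) (.of_forall fun _ => ENNReal.ofReal_lt_top)]
  refine IntegrableOn.congr_fun (hf.const_mul (r ^ a / Real.Gamma a)) (fun t ht => ?_) hs
  exact (gammaPDF_toReal_smul ha hr (hs0 ht) _).symm

theorem dF_eq_of_hasLaw_gammaMeasure {Ω : Type*} [MeasurableSpace Ω] {P : Measure Ω} {X : Ω → ℝ}
    {a r : ℝ} (ha : 0 < a) (hr : 0 < r) (hX : HasLaw X (gammaMeasure a r) P) :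
    dF P X = gammaMeasure a r := by
  have := isProbabilityMeasure_gammaMeasure ha hr
  rw [dF, hX.map_eq, measure_cdf]

theorem rpow_mul_exp_mul_exp (a r x t : ℝ) :
    t ^ (a - 1) * Real.exp (-(r * t)) * Real.exp (-(t * x)) =
      t ^ (a - 1) * Real.exp (-((x + r) * t)) := by
  rw [mul_assoc, ← Real.exp_add]
  ring_nf

theorem rpow_mul_exp_mul_self_mul_exp (a r x : ℝ) {t : ℝ} (ht : 0 < t) :
    t ^ (a - 1) * Real.exp (-(r * t)) * (t * Real.exp (-(t * x))) =
      t ^ (a + 1 - 1) * Real.exp (-((x + r) * t)) := by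
  rw [show a + 1 - 1 = (a - 1) + 1 by ring, Real.rpow_add_one ht.ne',
    show -((x + r) * t) = -(r * t) + -(t * x) by ring, Real.exp_add]
  ring

/-! ### The double integrals -/

theorem mainTheorem9 {Ω : Type*} [MeasurableSpace Ω] (P : Measure Ω) [IsProbabilityMeasure P]
    (X Y : Ω → ℝ) (α₁ α₂ lam₁ lam₂ : ℝ)
    (hα₁ : 0 < α₁) (hα₂ : 0 < α₂) (hlam₁ : 0 < lam₁) (hlam₂ : 0 < lam₂)
    (hX : HasLaw X (gammaMeasure α₁ lam₁) P) (hY : HasLaw Y (gammaMeasure α₂ lam₂) P)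
    (x : ℝ) (hx₁ : -lam₁ < x) (hx₂ : -lam₂ < x) :
    -- the argument of the hypergeometric function lies in its disc of convergence
    |(x + lam₂) / (2 * x + lam₁ + lam₂)| < 1 ∧
    -- all the integrals below converge absolutely
    (∀ u : ℝ, 0 < u →
      IntegrableOn (fun v => Real.exp (-(v * x))) (Set.Ioc 0 u) (dF P Y) ∧
      IntegrableOn (fun v => v * Real.exp (-(v * x))) (Set.Ioc 0 u) (dF P Y)) ∧
    IntegrableOn
      (fun u => (∫ v in Set.Ioc 0 u, Real.exp (-(v * x)) ∂(dF P Y)) *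
        (u * Real.exp (-(u * x)))) (Set.Ioi 0) (dF P X) ∧
    IntegrableOn
      (fun u => (∫ v in Set.Ioc 0 u, v * Real.exp (-(v * x)) ∂(dF P Y)) *
        Real.exp (-(u * x))) (Set.Ioi 0) (dF P X) ∧
    -- the first closed form
    (∫ u in Set.Ioi 0, (∫ v in Set.Ioc 0 u, Real.exp (-(v * x)) ∂(dF P Y)) *
        (u * Real.exp (-(u * x))) ∂(dF P X)) =
      lam₁ ^ α₁ * lam₂ ^ α₂ / betaFn α₁ (α₂ + 1) *
        (₂F₁ (α₁ + α₂ + 1) 1 (α₂ + 1) ((x + lam₂) / (2 * x + lam₁ + lam₂)) /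
          (2 * x + lam₁ + lam₂) ^ (α₁ + α₂ + 1)) ∧
    -- the second closed form
    (∫ u in Set.Ioi 0, (∫ v in Set.Ioc 0 u, v * Real.exp (-(v * x)) ∂(dF P Y)) *
        Real.exp (-(u * x)) ∂(dF P X)) =
      lam₁ ^ α₁ * lam₂ ^ α₂ / betaFn α₁ α₂ *
        (₂F₁ (α₁ + α₂) 1 (α₂ + 1) ((x + lam₂) / (2 * x + lam₁ + lam₂)) /
          ((x + lam₂) * (2 * x + lam₁ + lam₂) ^ (α₁ + α₂))) -
      lam₁ ^ α₁ * lam₂ ^ α₂ / betaFn α₁ α₂ *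
        (1 / ((x + lam₂) * (2 * x + lam₁ + lam₂) ^ (α₁ + α₂))) := by
  have hp : 0 < x + lam₁ := by linarith
  have hq : 0 < x + lam₂ := by linarith
  have hs : 2 * x + lam₁ + lam₂ = (x + lam₁) + (x + lam₂) := by ring
  rw [dF_eq_of_hasLaw_gammaMeasure hα₁ hlam₁ hX, dF_eq_of_hasLaw_gammaMeasure hα₂ hlam₂ hY, hs]
  generalize hpdef : x + lam₁ = p at *
  generalize hqdef : x + lam₂ = q at *
  have hz : |q / (p + q)| < 1 := by
    rw [abs_of_pos (by positivity), div_lt_one (by positivity)]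
    linarith
  have hα₂' : 0 < α₂ + 1 := by positivity
  have hα₁' : 0 < α₁ + 1 := by positivity
  have hΓ₁ := Real.Gamma_pos_of_pos hα₁
  have hΓ₂ := Real.Gamma_pos_of_pos hα₂
  -- The factors `v` and `e^(-vx)` are absorbed into the density of `Y`, the former by raising the
  -- exponent of `v`, the latter by raising the rate to `q`.
  have hinner₁ (u : ℝ) : ∫ v in Set.Ioc 0 u, Real.exp (-(v * x)) ∂(gammaMeasure α₂ lam₂) =
      lam₂ ^ α₂ / Real.Gamma α₂ *
        ∫ v in Set.Ioc 0 u, v ^ (α₂ - 1) * Real.exp (-(q * v)) := by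
    rw [setIntegral_gammaMeasure hα₂ hlam₂ measurableSet_Ioc Set.Ioc_subset_Ioi_self]
    simp_rw [rpow_mul_exp_mul_exp, hqdef]
  have hinner₂ (u : ℝ) : ∫ v in Set.Ioc 0 u, v * Real.exp (-(v * x)) ∂(gammaMeasure α₂ lam₂) =
      lam₂ ^ α₂ / Real.Gamma α₂ *
        ∫ v in Set.Ioc 0 u, v ^ (α₂ + 1 - 1) * Real.exp (-(q * v)) := by
    rw [setIntegral_gammaMeasure hα₂ hlam₂ measurableSet_Ioc Set.Ioc_subset_Ioi_self]
    congr 1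
    refine setIntegral_congr_fun measurableSet_Ioc fun v hv => ?_
    rw [← hqdef]
    exact rpow_mul_exp_mul_self_mul_exp _ _ _ hv.1
  simp_rw [hinner₁, hinner₂]
  set L : ℝ → ℝ → ℝ := fun b u => ∫ v in Set.Ioc 0 u, v ^ (b - 1) * Real.exp (-(q * v)) with hL
  -- The same for the factors `u` and `e^(-ux)` and the density of `X`.
  have houter₁ : Set.EqOn (fun u => u ^ (α₁ - 1) * Real.exp (-(lam₁ * u)) *
      (lam₂ ^ α₂ / Real.Gamma α₂ * L α₂ u * (u * Real.exp (-(u * x)))))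
      (fun u => lam₂ ^ α₂ / Real.Gamma α₂ *
        (L α₂ u * (u ^ (α₁ + 1 - 1) * Real.exp (-(p * u))))) (Set.Ioi 0) := by
    intro u hu
    have h := rpow_mul_exp_mul_self_mul_exp α₁ lam₁ x hu
    rw [hpdef] at h
    simp only [← h]
    ring
  have houter₂ : Set.EqOn (fun u => u ^ (α₁ - 1) * Real.exp (-(lam₁ * u)) *
      (lam₂ ^ α₂ / Real.Gamma α₂ * L (α₂ + 1) u * Real.exp (-(u * x))))
      (fun u => lam₂ ^ α₂ / Real.Gamma α₂ *
        (L (α₂ + 1) u * (u ^ (α₁ - 1) * Real.exp (-(p * u))))) (Set.Ioi 0) := by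
    intro u hu
    have h := rpow_mul_exp_mul_exp α₁ lam₁ x u
    rw [hpdef] at h
    simp only [← h]
    ring
  refine ⟨hz, fun u _ => ⟨?_, ?_⟩, ?_, ?_, ?_, ?_⟩
  · refine integrableOn_gammaMeasure hα₂ hlam₂ measurableSet_Ioc Set.Ioc_subset_Ioi_self ?_
    simp_rw [rpow_mul_exp_mul_exp, hqdef]
    exact (integrableOn_rpow_mul_exp_neg_Ioi hα₂ hq).mono_set Set.Ioc_subset_Ioi_self
  · refine integrableOn_gammaMeasure hα₂ hlam₂ measurableSet_Ioc Set.Ioc_subset_Ioi_self ?_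
    refine IntegrableOn.congr_fun ((integrableOn_rpow_mul_exp_neg_Ioi hα₂' hq).mono_set
      Set.Ioc_subset_Ioi_self) (fun v hv => ?_) measurableSet_Ioc
    rw [← hqdef]
    exact (rpow_mul_exp_mul_self_mul_exp _ _ _ hv.1).symm
  · refine integrableOn_gammaMeasure hα₁ hlam₁ measurableSet_Ioi subset_rfl ?_
    exact IntegrableOn.congr_fun
      ((integrableOn_lowerGamma_mul_rpow_mul_exp hα₁' hα₂ hp hq).const_mul _)
      houter₁.symm measurableSet_Ioi
  · refine integrableOn_gammaMeasure hα₁ hlam₁ measurableSet_Ioi subset_rfl ?_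
    exact IntegrableOn.congr_fun
      ((integrableOn_lowerGamma_mul_rpow_mul_exp hα₁ hα₂' hp hq).const_mul _)
      houter₂.symm measurableSet_Ioi
  · rw [setIntegral_gammaMeasure hα₁ hlam₁ measurableSet_Ioi subset_rfl,
      setIntegral_congr_fun measurableSet_Ioi houter₁, integral_const_mul,
      integral_lowerGamma_mul_rpow_mul_exp hα₁' hα₂ hp hq, betaFn_eq_beta hα₁ hα₂', beta,
      Real.Gamma_add_one hα₂.ne', add_right_comm α₁ 1, ← add_assoc]
    have := Real.Gamma_pos_of_pos (show 0 < α₁ + α₂ + 1 by positivity)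
    field_simp
  · have hα : 0 < α₁ + α₂ := by positivity
    have := Real.Gamma_pos_of_pos hα
    rw [setIntegral_gammaMeasure hα₁ hlam₁ measurableSet_Ioi subset_rfl,
      setIntegral_congr_fun measurableSet_Ioi houter₂, integral_const_mul,
      integral_lowerGamma_mul_rpow_mul_exp hα₁ hα₂' hp hq, betaFn_eq_beta hα₁ hα₂, beta,
      ordinaryHypergeometric_one_eq_one_add hα hα₂' (by positivity) (lt_of_abs_lt hz),
      ← add_assoc, Real.Gamma_add_one hα.ne', Real.rpow_add_one (by positivity)]
    field_simp
    ring
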